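/- For a prime power $q$ let $G=\mathrm{PSL}_2(q)$ be the quotient of $\mathrm{SL}_2(\mathbb{F}_q)$ by its centre. An element of $G$ is called unipotent if it has a preimage in $\mathrm{SL}_2(\mathbb{F}_q)$ with Jordan form $\begin{pmatrix}\pm1&1\\0&\pm1\end{pmatrix}$ (so the identity is not unipotent), and semisimple if it has a preimage in $\mathrm{SL}_2(\mathbb{F}_q)$ that is diagonalizable over $\overline{\mathbb{F}_q}$. Let $\mathcal{C}$ be the $G$-conjugacy class of a nontrivial element $x\in G$, and let $\mathcal{C}^2=\{yz : y,z\in\mathcal{C}\}$. Then, as $q\to\infty$ (uniformly over all $x$ of the stated type in $\mathrm{PSL}_2(q)$): 1. if $q$ is even, then $\dfrac{|\mathcal{C}|}{|G|^{2/3}}\to 1$ and $\dfrac{|\mathcal{C}^2|}{|G|}\to 1$; 2. if $q$ is odd and $x$ is semisimple of order greater than $2$, then $\dfrac{|\mathcal{C}|}{|G|^{2/3}}\to\sqrt[3]{4}$ and $\dfrac{|\mathcal{C}^2|}{|G|}\to 1$; 3. if $q$ is odd and $x$ has order $2$, then $\dfrac{|\mathcal{C}|}{|G|^{2/3}}\to\dfrac{1}{\sqrt[3]{2}}$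 and $\dfrac{|\mathcal{C}^2|}{|G|}\to 1$; 4. if $q$ is odd and $x$ is unipotent, then $\dfrac{|\mathcal{C}|}{|G|^{2/3}}\to\dfrac{1}{\sqrt[3]{2}}$ and $\dfrac{|\mathcal{C}^2|}{|G|}\to\dfrac{3}{4}$. -/

import Mathlib

universe u

open scoped Pointwise

/-- The group `PSL₂(F)`: the quotient of `SL₂(F)` by its centre. -/
abbrev PSL2 (F : Type*) [Field F] : Type _ :=
  Matrix.ProjectiveSpecialLinearGroup (Fin 2) F

/-- `A ∈ SL₂(F)`, viewed over an algebraic closure of `F`, is conjugate to the matrix `J`. -/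
def HasJordanForm {F : Type*} [Field F] (A : Matrix.SpecialLinearGroup (Fin 2) F)
    (J : Matrix (Fin 2) (Fin 2) (AlgebraicClosure F)) : Prop :=
  ∃ P : GL (Fin 2) (AlgebraicClosure F),
    (P : Matrix (Fin 2) (Fin 2) (AlgebraicClosure F)) *
        (A : Matrix (Fin 2) (Fin 2) F).map (algebraMap F (AlgebraicClosure F)) *
        ((P⁻¹ : GL (Fin 2) (AlgebraicClosure F)) :
          Matrix (Fin 2) (Fin 2) (AlgebraicClosure F)) = J

namespace PSL2

variable {F : Type*} [Field F]

/-- An element of `PSL₂(F)` is unipotent if it has a preimage in `SL₂(F)` whose Jordan form is a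
single `2 × 2` block with eigenvalue `1` or `-1`. (So the identity is not unipotent.) -/
def IsUnipotent (x : PSL2 F) : Prop :=
  ∃ A : Matrix.SpecialLinearGroup (Fin 2) F, (QuotientGroup.mk A : PSL2 F) = x ∧
    (HasJordanForm A !![1, 1; 0, 1] ∨ HasJordanForm A !![-1, 1; 0, -1])

/-- An element of `PSL₂(F)` is semisimple if it has a preimage in `SL₂(F)` that is diagonalizable
over an algebraic closure of `F`. -/
def IsSemisimple (x : PSL2 F) : Prop :=
  ∃ A : Matrix.SpecialLinearGroup (Fin 2) F, (QuotientGroup.mk A : PSL2 F) = x ∧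
    ∃ a : AlgebraicClosure F, a ≠ 0 ∧ HasJordanForm A !![a, 0; 0, a⁻¹]

/-- `|C| / |G|^(2/3)`, where `G = PSL₂(F)` and `C` is the conjugacy class of `x` in `G`. -/
noncomputable def classRatio (x : PSL2 F) : ℝ :=
  ((conjugatesOf x).ncard : ℝ) / (Nat.card (PSL2 F) : ℝ) ^ (2 / 3 : ℝ)

/-- `|C²| / |G|`, where `G = PSL₂(F)`, `C` is the conjugacy class of `x` in `G`, and `C²` is the
set of all products of two elements of `C`. -/
noncomputable def squareRatio (x : PSL2 F) : ℝ :=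
  ((conjugatesOf x * conjugatesOf x : Set (PSL2 F)).ncard : ℝ) / (Nat.card (PSL2 F) : ℝ)

end PSL2

/-! Everything is computed in `SL(2, F)` and pushed down by the centre, of order 1 or 2. With `q =
|F|`, each trace fibre has `q² + O(q)` elements (`abs_ncard_trace_mem_sub_le`), so `|SL(2, F)| = q³
+ O(q²)`. A fibre of trace other than `±2` is a single conjugacy class (`isConj_of_trace_eq`): the
form `det(v, Av)` has discriminant `tr² - 4 ≠ 0`, hence takes the value 1, which makes `A` conjugate
to a companion matrix.

Class sizes follow by counting fibres. A lift of trace `t` contributes the fibres over `t` and `-t`,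
which coincide for involutions since these are the elements with `t = 0`. For `q` odd a unipotent
class has `q²/2 + O(q)` elements because its centralizer in `SL(2, F)` has order `2q`.

For squares of classes, a point on a conic writes any matrix of trace other than `±2` as a product
of two matrices of a prescribed trace (`exists_mul_eq_of_sq_trace_ne`). So `C²` misses only `O(q²)`
elements, unless `q` is odd and the class is unipotent. In that case a product of two conjugates of
`upperUnipotent u` has trace `2 - s²`, and every such trace except `±2` fills its whole fibre. Up to
sign the condition is that `2 - t` or `2 + t` is a square, which a Jacobi sum shows to hold for
about `3/4` of all `t` (`abs_card_isSquare_or_sub_le`). -/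

open scoped MatrixGroups

/-! ### Points on conics over finite fields. -/

namespace FiniteField

variable {F : Type*} [Field F] [Finite F]

lemma two_ne_zero_of_odd_card (hq : Odd (Nat.card F)) : (2 : F) ≠ 0 := by
  have := Fintype.ofFinite F
  rw [Nat.card_eq_fintype_card] at hq
  refine Ring.two_ne_zero fun h ↦ ?_
  have := FiniteField.even_card_iff_char_two.1 h
  have := Nat.odd_iff.1 hq
  omega

lemma ringChar_eq_two_of_even_card (hq : Even (Nat.card F)) : ringChar F = 2 := by
  have := Fintype.ofFinite F
  rw [Nat.card_eq_fintype_card] at hq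
  exact FiniteField.even_card_iff_char_two.2 (Nat.even_iff.1 hq)

lemma two_eq_zero_of_even_card (hq : Even (Nat.card F)) : (2 : F) = 0 := by
  have h := ringChar.Nat.cast_ringChar (R := F)
  rw [ringChar_eq_two_of_even_card hq] at h
  exact_mod_cast h

lemma exists_sq_eq_of_even_card (hq : Even (Nat.card F)) (a : F) : ∃ x, x ^ 2 = a := by
  obtain ⟨x, hx⟩ := FiniteField.isSquare_of_char_two (ringChar_eq_two_of_even_card hq) a
  exact ⟨x, by rw [hx, sq]⟩

lemma four_ne_zero_of_odd_card (hq : Odd (Nat.card F)) : (4 : F) ≠ 0 := by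
  have h2 := two_ne_zero_of_odd_card hq
  rw [show (4 : F) = 2 * 2 by norm_num]
  exact mul_ne_zero h2 h2

/-- A nondegenerate conic with a nonzero leading coefficient has a point over a finite field of odd
order. -/
lemma exists_conic_point_of_odd (hq : Odd (Nat.card F)) (A B C D E n : F) (hA : A ≠ 0)
    (hdisc : B ^ 2 - 4 * A * C ≠ 0) :
    ∃ x y : F, A * x ^ 2 + B * x * y + C * y ^ 2 + D * x + E * y + n = 0 := by
  have h2 : (2 : F) ≠ 0 := two_ne_zero_of_odd_card hq
  have h4 := four_ne_zero_of_odd_card hq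
  have := Fintype.ofFinite F
  rw [Nat.card_eq_fintype_card] at hq
  -- Completing the square in `x` removes the cross term; this is the remaining coefficient of `y²`.
  have hC : C - B ^ 2 / (4 * A) ≠ 0 := by
    intro h
    apply hdisc
    field_simp at h
    linear_combination -h
  obtain ⟨a, b, hab⟩ := FiniteField.exists_root_sum_quadratic
    (f := Polynomial.C A * Polynomial.X ^ 2 + Polynomial.C D * Polynomial.X + Polynomial.C n)
    (g := Polynomial.C (C - B ^ 2 / (4 * A)) * Polynomial.X ^ 2
      + Polynomial.C (E - D * B / (2 * A)) * Polynomial.X + Polynomial.C 0)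
    (Polynomial.degree_quadratic hA) (Polynomial.degree_quadratic hC) (Nat.odd_iff.1 hq)
  refine ⟨a - B * b / (2 * A), b, ?_⟩
  simp only [Polynomial.eval_add, Polynomial.eval_mul, Polynomial.eval_C, Polynomial.eval_pow,
    Polynomial.eval_X] at hab
  rw [← hab, show (4 : F) = 2 * 2 by norm_num]
  field_simp
  ring

/-- The conic `x² - txy + y² + lx + my + n = 0` has a point if its quadratic part is
nondegenerate. -/
lemma exists_conic_point (t l m n : F) (ht : t ^ 2 ≠ 4) :
    ∃ x y : F, x ^ 2 - t * x * y + y ^ 2 + l * x + m * y + n = 0 := by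
  rcases Nat.even_or_odd (Nat.card F) with hq | hq
  · have h2 := two_eq_zero_of_even_card hq
    have ht0 : t ≠ 0 := by
      rintro rfl
      apply ht
      linear_combination (-2 : F) * h2
    -- On the line `y = l / t` the terms `-t x y` and `l x` cancel, leaving `x²` equal to a
    -- constant.
    obtain ⟨x, hx⟩ := exists_sq_eq_of_even_card hq (-((l / t) ^ 2 + m * (l / t) + n))
    refine ⟨x, l / t, ?_⟩
    rw [hx]
    field_simp
    ring
  · obtain ⟨x, y, h⟩ := exists_conic_point_of_odd hq 1 (-t) 1 l m n one_ne_zero (by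
      intro h; apply ht; linear_combination h)
    exact ⟨x, y, by linear_combination h⟩

end FiniteField

/-! ### Conjugacy by trace, and products of prescribed trace. -/

namespace Matrix.SpecialLinearGroup

section Field

variable {F : Type*} [Field F]

lemma det_fin_two_eq_one (A : SL(2, F)) : A.1 0 0 * A.1 1 1 - A.1 0 1 * A.1 1 0 = 1 := by
  rw [← Matrix.det_fin_two, A.2]

/-- The companion matrix of `X² - tX + 1`. -/
def companion (t : F) : SL(2, F) := ⟨!![0, -1; 1, t], by simp⟩

@[simp] lemma trace_companion (t : F) : (companion t).1.trace = t := by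
  simp [companion, Matrix.trace_fin_two]

lemma trace_eq_of_isConj {A B : SL(2, F)} (h : IsConj A B) : A.1.trace = B.1.trace := by
  obtain ⟨P, rfl⟩ := isConj_iff.1 h
  change _ = (P.1 * A.1 * (P⁻¹).1).trace
  rw [Matrix.trace_mul_comm, ← mul_assoc]
  change _ = ((P⁻¹ * P).1 * A.1).trace
  simp

lemma isConj_of_mul_eq_mul {G : Type*} [Group G] {c a b : G} (h : c * a = b * c) : IsConj a b :=
  isConj_iff.2 ⟨c, mul_inv_eq_iff_eq_mul.2 h⟩

/-- If `v` and `A v` span a parallelogram of area one, then `A` is conjugate to a companion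
matrix. -/
lemma isConj_companion_of_form_eq_one (A : SL(2, F)) (v w : F)
    (h : A.1 1 0 * v ^ 2 + (A.1 1 1 - A.1 0 0) * v * w - A.1 0 1 * w ^ 2 = 1) :
    IsConj A (companion A.1.trace) := by
  have hd := det_fin_two_eq_one A
  let P : SL(2, F) := ⟨!![v, A.1 0 0 * v + A.1 0 1 * w; w, A.1 1 0 * v + A.1 1 1 * w],
    by rw [Matrix.det_fin_two_of]; linear_combination h⟩
  refine IsConj.symm (isConj_of_mul_eq_mul (c := P) (Subtype.ext ?_))
  change !![v, A.1 0 0 * v + A.1 0 1 * w; w, A.1 1 0 * v + A.1 1 1 * w] *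
    !![0, -1; 1, A.1.trace] =
    A.1 * !![v, A.1 0 0 * v + A.1 0 1 * w; w, A.1 1 0 * v + A.1 1 1 * w]
  ext i j
  fin_cases i <;> fin_cases j <;>
    simp [Matrix.mul_apply, Fin.sum_univ_two, Matrix.trace_fin_two]
  · linear_combination v * hd
  · linear_combination w * hd

end Field

variable {F : Type*} [Field F] [Finite F]

/-- The form `det(v, Av)` has discriminant `tr² - 4`, so it is nondegenerate and represents 1 over a
finite field of odd order. -/
lemma isConj_companion_of_sq_trace_ne (A : SL(2, F)) (hA : A.1.trace ^ 2 ≠ 4)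
    (hq : Odd (Nat.card F)) : IsConj A (companion A.1.trace) := by
  have hd := det_fin_two_eq_one A
  have hdisc : (A.1 1 1 - A.1 0 0) ^ 2 + 4 * A.1 1 0 * A.1 0 1 ≠ 0 := by
    intro h
    apply hA
    rw [Matrix.trace_fin_two]
    linear_combination h + 4 * hd
  suffices ∃ v w : F,
      A.1 1 0 * v ^ 2 + (A.1 1 1 - A.1 0 0) * v * w - A.1 0 1 * w ^ 2 = 1 by
    obtain ⟨v, w, h⟩ := this
    exact isConj_companion_of_form_eq_one A v w h
  by_cases h1 : A.1 1 0 = 0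
  · by_cases h2 : A.1 0 1 = 0
    · have h3 : A.1 1 1 - A.1 0 0 ≠ 0 := by
        intro h3
        simp [h1, h3] at hdisc
      exact ⟨1, (A.1 1 1 - A.1 0 0)⁻¹, by simp [h1, h2, h3]⟩
    · obtain ⟨w, v, h⟩ := FiniteField.exists_conic_point_of_odd hq (-A.1 0 1)
        (A.1 1 1 - A.1 0 0) (A.1 1 0) 0 0 (-1) (by simpa using h2) (by
          intro h; apply hdisc; linear_combination h)
      exact ⟨v, w, by linear_combination h⟩
  · obtain ⟨v, w, h⟩ := FiniteField.exists_conic_point_of_odd hq (A.1 1 0)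
      (A.1 1 1 - A.1 0 0) (-A.1 0 1) 0 0 (-1) h1 (by
        intro h; apply hdisc; linear_combination h)
    exact ⟨v, w, by linear_combination h⟩

/-- Every element is a square, so a nonzero coefficient of `v²` or `w²` already makes the form
represent 1. If both vanish, `A` is diagonal and `A ≠ 1` keeps the coefficient of `v w` nonzero.
Transvections are covered too, so no trace has to be excluded. -/
lemma isConj_companion_of_even (A : SL(2, F)) (hA : A ≠ 1) (hq : Even (Nat.card F)) :
    IsConj A (companion A.1.trace) := by
  have hd := det_fin_two_eq_one A
  have h2 := FiniteField.two_eq_zero_of_even_card hq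
  suffices ∃ v w : F,
      A.1 1 0 * v ^ 2 + (A.1 1 1 - A.1 0 0) * v * w - A.1 0 1 * w ^ 2 = 1 by
    obtain ⟨v, w, h⟩ := this
    exact isConj_companion_of_form_eq_one A v w h
  by_cases h10 : A.1 1 0 = 0
  · by_cases h01 : A.1 0 1 = 0
    · have h3 : A.1 1 1 - A.1 0 0 ≠ 0 := by
        intro h3
        have h4 : (A.1 0 0 - 1) ^ 2 = 0 := by
          rw [h01] at hd
          linear_combination hd - A.1 0 0 * h3 + (1 - A.1 0 0) * h2
        have h5 : A.1 0 0 = 1 := sub_eq_zero.1 (pow_eq_zero_iff two_ne_zero |>.1 h4)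
        have h6 : A.1 1 1 = 1 := by linear_combination h3 + h5
        apply hA
        apply Subtype.ext
        ext i j
        fin_cases i <;> fin_cases j <;> simp [h10, h01, h5, h6]
      exact ⟨1, (A.1 1 1 - A.1 0 0)⁻¹, by simp [h10, h01, h3]⟩
    · obtain ⟨w, hw⟩ := FiniteField.exists_sq_eq_of_even_card hq (-(A.1 0 1)⁻¹)
      exact ⟨0, w, by rw [hw]; field_simp; ring⟩
  · obtain ⟨v, hv⟩ := FiniteField.exists_sq_eq_of_even_card hq (A.1 1 0)⁻¹
    exact ⟨v, 0, by rw [hv]; field_simp; ring⟩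

lemma isConj_of_trace_eq {A B : SL(2, F)} (h : A.1.trace = B.1.trace) (hA : A.1.trace ^ 2 ≠ 4) :
    IsConj A B := by
  have key : ∀ C : SL(2, F), C.1.trace ^ 2 ≠ 4 → IsConj C (companion C.1.trace) := by
    intro C hC
    rcases Nat.even_or_odd (Nat.card F) with hq | hq
    · refine isConj_companion_of_even C ?_ hq
      rintro rfl
      apply hC
      simp
      norm_num
    · exact isConj_companion_of_sq_trace_ne C hC hq
  have h1 := key A hA
  rw [h] at h1 hA
  exact h1.trans (key B hA).symm

lemma isConj_of_trace_eq_of_even {A B : SL(2, F)} (h : A.1.trace = B.1.trace) (hA : A ≠ 1)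
    (hB : B ≠ 1) (hq : Even (Nat.card F)) : IsConj A B := by
  have h1 := isConj_companion_of_even A hA hq
  rw [h] at h1
  exact h1.trans (isConj_companion_of_even B hB hq).symm

/-- A matrix `M` that is conjugate to a product `E * H` is itself such a product, of conjugates
of `E` and `H`. -/
lemma exists_isConj_mul {G : Type*} [Group G] {M E H : G} (h : IsConj (E * H) M) :
    ∃ E' H' : G, IsConj E E' ∧ IsConj H H' ∧ E' * H' = M := by
  obtain ⟨c, rfl⟩ := isConj_iff.1 h
  exact ⟨c * E * c⁻¹, c * H * c⁻¹, isConj_iff.2 ⟨c, rfl⟩, isConj_iff.2 ⟨c, rfl⟩, by group⟩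

/-- Every matrix whose trace is not `±2` is a product of two matrices of any prescribed trace. -/
lemma exists_mul_eq_of_sq_trace_ne (a : F) (M : SL(2, F)) (hM : M.1.trace ^ 2 ≠ 4) :
    ∃ E H : SL(2, F), E.1.trace = a ∧ H.1.trace = a ∧ E * H = M := by
  set t := M.1.trace with ht
  -- The matrix `H` below is parametrized so that both `H` and `E = companion t * H⁻¹` have trace
  -- `a`; the only remaining condition, `det H = 1`, is this conic.
  obtain ⟨x, y, hxy⟩ := FiniteField.exists_conic_point t (-a) (a * t - a) 1 hM
  let E : SL(2, F) := ⟨!![a - x, -y; -(y + (a - x) * t - a), x], by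
    rw [Matrix.det_fin_two_of]; linear_combination -hxy⟩
  have hE : E.1.trace = a := by simp [E, Matrix.trace_fin_two]
  let H : SL(2, F) := ⟨!![y, -x + y * t; a - x, a - y], by
    rw [Matrix.det_fin_two_of]; linear_combination -hxy⟩
  have hH : H.1.trace = a := by simp [H, Matrix.trace_fin_two]
  have hEH : E * H = companion t := by
    apply Subtype.ext
    change !![a - x, -y; -(y + (a - x) * t - a), x] * !![y, -x + y * t; a - x, a - y] =
      !![0, -1; 1, t]
    ext i j
    fin_cases i <;> fin_cases j <;> simp [Matrix.mul_apply, Fin.sum_univ_two]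
    · ring
    · linear_combination hxy
    · linear_combination -hxy
    · linear_combination -t * hxy
  obtain ⟨E', H', h1, h2, h3⟩ := exists_isConj_mul (E := E) (H := H) (M := M) (by
    rw [hEH]
    exact isConj_of_trace_eq (by simp [ht]) (by simpa using hM))
  exact ⟨E', H', by rw [← trace_eq_of_isConj h1, hE], by rw [← trace_eq_of_isConj h2, hH], h3⟩

end Matrix.SpecialLinearGroup

/-! ### Sizes of trace fibres and of unipotent classes. -/

lemma ncard_conjugatesOf_mul_ncard_commute {G : Type*} [Group G] [Finite G] (g : G) :
    (conjugatesOf g).ncard * {k : G | k * g = g * k}.ncard = Nat.card G := by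
  classical
  have := Fintype.ofFinite G
  have h := Subgroup.card_mul_index (MulAction.stabilizer (ConjAct G) g)
  rw [MulAction.index_stabilizer, ConjAct.orbit_eq_carrier_conjClasses, mul_comm] at h
  have h1 : (ConjClasses.mk g).carrier = conjugatesOf g := by
    ext x
    rw [ConjClasses.mem_carrier_iff_mk_eq, ConjClasses.mk_eq_mk_iff_isConj, isConj_comm]
    rfl
  rw [h1] at h
  have h2 : Nat.card (MulAction.stabilizer (ConjAct G) g) = {k : G | k * g = g * k}.ncard := by
    rw [← Nat.card_coe_set_eq]
    refine Nat.card_congr (ConjAct.ofConjAct.toEquiv.subtypeEquiv fun k ↦ ?_)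
    rw [MulAction.mem_stabilizer_iff, ConjAct.smul_def, mul_inv_eq_iff_eq_mul]
    rfl
  rw [h2] at h
  exact h

namespace Matrix.SpecialLinearGroup

lemma eq_of_entries {F : Type*} [Field F] {A B : SL(2, F)} (h00 : A.1 0 0 = B.1 0 0) (h01 : A.1 0 1 = B.1 0 1)
    (h10 : A.1 1 0 = B.1 1 0) (h11 : A.1 1 1 = B.1 1 1) : A = B := by
  apply Subtype.ext
  ext i j
  fin_cases i <;> fin_cases j <;> assumption

variable {F : Type*} [Field F] [Finite F]

/-- If the upper right entry is nonzero, the first row determines the matrix: at most `q(q - 1)`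
cases. If it is zero, the upper left entry is one of at most two roots of `x(a - x) = 1` and the
lower left entry is free: at most `2q` cases. -/
lemma ncard_trace_eq_le (a : F) :
    {M : SL(2, F) | M.1.trace = a}.ncard ≤ Nat.card F ^ 2 + Nat.card F := by
  classical
  have := Fintype.ofFinite F
  have hq : 0 < Nat.card F := Nat.card_pos
  let R : Set F := {x | x * (a - x) = 1}
  have hR : R.ncard ≤ 2 := by
    rcases R.eq_empty_or_nonempty with h | ⟨x₀, hx₀⟩
    · simp [h]
    · refine (Set.ncard_le_ncard (t := {x₀, a - x₀}) (fun x hx ↦ ?_)).trans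
        ((Set.ncard_insert_le _ _).trans (by simp))
      have h : (x - x₀) * (x - (a - x₀)) = 0 := by
        simp only [R, Set.mem_ofPred_eq] at hx hx₀
        linear_combination hx₀ - hx
      rcases mul_eq_zero.1 h with h | h
      · exact Or.inl (sub_eq_zero.1 h)
      · exact Or.inr (sub_eq_zero.1 h)
  have h1 : {M : SL(2, F) | M.1.trace = a ∧ M.1 0 1 ≠ 0}.ncard ≤
      ((Set.univ : Set F) ×ˢ ({0}ᶜ : Set F)).ncard := by
    refine Set.ncard_le_ncard_of_injOn (fun M ↦ (M.1 0 0, M.1 0 1)) (fun M hM ↦ ?_) ?_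
    · simpa using hM.2
    · rintro A ⟨hA, hA'⟩ B ⟨hB, hB'⟩ h
      simp only [Prod.mk.injEq] at h
      rw [Matrix.trace_fin_two] at hA hB
      have hA1 := det_fin_two_eq_one A
      have hB1 := det_fin_two_eq_one B
      have h11 : A.1 1 1 = B.1 1 1 := by linear_combination hA - hB - h.1
      refine eq_of_entries h.1 h.2 (mul_left_cancel₀ hA' ?_) h11
      rw [h.1, h11] at hA1
      rw [h.2] at hA1 ⊢
      linear_combination hB1 - hA1
  have h2 : {M : SL(2, F) | M.1.trace = a ∧ M.1 0 1 = 0}.ncard ≤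
      (R ×ˢ (Set.univ : Set F)).ncard := by
    refine Set.ncard_le_ncard_of_injOn (fun M ↦ (M.1 0 0, M.1 1 0)) (fun M hM ↦ ?_) ?_
    · have hM1 := hM.1
      rw [Matrix.trace_fin_two] at hM1
      have hd := det_fin_two_eq_one M
      rw [hM.2] at hd
      simp only [R, Set.mem_prod, Set.mem_ofPred_eq, Set.mem_univ, and_true]
      linear_combination hd - M.1 0 0 * hM1
    · rintro A ⟨hA, hA'⟩ B ⟨hB, hB'⟩ h
      simp only [Prod.mk.injEq] at h
      rw [Matrix.trace_fin_two] at hA hB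
      exact eq_of_entries h.1 (hA'.trans hB'.symm) h.2 (by linear_combination hA - hB - h.1)
  have h3 : {M : SL(2, F) | M.1.trace = a} ⊆ {M : SL(2, F) | M.1.trace = a ∧ M.1 0 1 ≠ 0} ∪
      {M : SL(2, F) | M.1.trace = a ∧ M.1 0 1 = 0} := by
    intro M hM
    by_cases h : M.1 0 1 = 0
    · exact Or.inr ⟨hM, h⟩
    · exact Or.inl ⟨hM, h⟩
  rw [Set.ncard_prod, Set.ncard_univ] at h1 h2
  have h4 := Set.ncard_add_ncard_compl ({0} : Set F)
  rw [Set.ncard_singleton] at h4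
  have h5 := (Set.ncard_le_ncard h3).trans (Set.ncard_union_le _ _)
  obtain ⟨n, hn⟩ : ∃ n, Nat.card F = n + 1 := ⟨_, (Nat.succ_pred_eq_of_pos hq).symm⟩
  have h6 : ({0}ᶜ : Set F).ncard = n := by omega
  rw [h6] at h1
  rw [hn] at h1 h2 ⊢
  nlinarith

/-- Any first row with nonzero second entry completes to a matrix of trace `a`, which gives `q(q -
1)` of them. -/
lemma card_sq_le_ncard_trace_eq (a : F) :
    Nat.card F ^ 2 ≤ {M : SL(2, F) | M.1.trace = a}.ncard + Nat.card F := by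
  let f : F × Fˣ → SL(2, F) := fun p ↦ ⟨!![p.1, p.2; (p.1 * (a - p.1) - 1) / p.2, a - p.1], by
    rw [Matrix.det_fin_two_of]
    have := p.2.ne_zero
    field_simp
    ring⟩
  have hf : f.Injective := by
    rintro ⟨x, b⟩ ⟨y, c⟩ h
    have h1 : x = y := congrArg (fun M : SL(2, F) ↦ M.1 0 0) h
    have h2 : (b : F) = c := congrArg (fun M : SL(2, F) ↦ M.1 0 1) h
    rw [h1, Units.ext h2]
  have h1 : (Set.range f).ncard ≤ {M : SL(2, F) | M.1.trace = a}.ncard := by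
    refine Set.ncard_le_ncard ?_
    rintro _ ⟨p, rfl⟩
    change (f p).1.trace = a
    simp [f, Matrix.trace_fin_two]
  rw [← Set.image_univ, Set.ncard_image_of_injective _ hf, Set.ncard_univ, Nat.card_prod] at h1
  rw [Nat.card_eq_card_units_add_one (α := F)] at h1 ⊢
  nlinarith

/-- The number of matrices in `SL₂(F)` with trace in `S` is close to `|S| q²`. -/
lemma abs_ncard_trace_mem_sub_le (S : Finset F) :
    |({M : SL(2, F) | M.1.trace ∈ S}.ncard : ℝ) - S.card * (Nat.card F : ℝ) ^ 2| ≤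
      S.card * (Nat.card F : ℝ) := by
  classical
  induction S using Finset.induction_on with
  | empty => simp
  | insert a S ha ih =>
    have h : {M : SL(2, F) | M.1.trace ∈ insert a S} =
        {M : SL(2, F) | M.1.trace = a} ∪ {M : SL(2, F) | M.1.trace ∈ S} := by
      ext M
      simp
    have hdisj : Disjoint {M : SL(2, F) | M.1.trace = a} {M : SL(2, F) | M.1.trace ∈ S} := by
      rw [Set.disjoint_left]
      intro M hM hM'
      apply ha
      rw [Set.mem_ofPred_eq] at hM hM'
      rwa [hM] at hM'
    rw [h, Set.ncard_union_eq hdisj, Finset.card_insert_of_notMem ha]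
    have h1 : ({M : SL(2, F) | M.1.trace = a}.ncard : ℝ) ≤ (Nat.card F : ℝ) ^ 2 + Nat.card F := by
      exact_mod_cast ncard_trace_eq_le a
    have h2 : (Nat.card F : ℝ) ^ 2 ≤ ({M : SL(2, F) | M.1.trace = a}.ncard : ℝ) + Nat.card F := by
      exact_mod_cast card_sq_le_ncard_trace_eq a
    rw [abs_le] at ih ⊢
    push_cast
    constructor <;> linarith [ih.1, ih.2]

lemma abs_ncard_trace_eq_sub_le (a : F) :
    |({M : SL(2, F) | M.1.trace = a}.ncard : ℝ) - (Nat.card F : ℝ) ^ 2| ≤ Nat.card F := by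
  simpa using abs_ncard_trace_mem_sub_le {a}

lemma abs_card_sub_le : |(Nat.card SL(2, F) : ℝ) - (Nat.card F : ℝ) ^ 3| ≤ (Nat.card F : ℝ) ^ 2 := by
  have := Fintype.ofFinite F
  have h := abs_ncard_trace_mem_sub_le (Finset.univ : Finset F)
  simp only [Finset.mem_univ, Set.ofPred_true, Set.ncard_univ, Finset.card_univ,
    ← Nat.card_eq_fintype_card] at h
  convert h using 2 <;> ring

/-- The unipotent upper triangular matrix with off-diagonal entry `u`. -/
def upperUnipotent {F : Type*} [Field F] (u : F) : SL(2, F) := ⟨!![1, u; 0, 1], by simp⟩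

/-- The centralizer consists of the upper triangular matrices with equal diagonal entries `±1`. -/
lemma ncard_commute_upperUnipotent (hq : Odd (Nat.card F)) {u : F} (hu : u ≠ 0) :
    {k : SL(2, F) | k * upperUnipotent u = upperUnipotent u * k}.ncard = 2 * Nat.card F := by
  have h2 := FiniteField.two_ne_zero_of_odd_card hq
  have hne : (1 : F) ≠ -1 := by
    intro h
    apply h2
    linear_combination h
  have key : {k : SL(2, F) | k * upperUnipotent u = upperUnipotent u * k}.ncard =
      (({1, -1} : Set F) ×ˢ (Set.univ : Set F)).ncard := by
    have hk : ∀ k : SL(2, F), k * upperUnipotent u = upperUnipotent u * k →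
        (k.1 0 0 = 1 ∨ k.1 0 0 = -1) ∧ k.1 1 0 = 0 ∧ k.1 1 1 = k.1 0 0 := by
      intro k hk
      have hk' : k.1 * !![1, u; 0, 1] = !![1, u; 0, 1] * k.1 := congrArg Subtype.val hk
      have e00 := congrFun (congrFun hk' 0) 0
      have e01 := congrFun (congrFun hk' 0) 1
      simp [Matrix.mul_apply, Fin.sum_univ_two, hu] at e00 e01
      have hd := det_fin_two_eq_one k
      have h11 : k.1 1 1 = k.1 0 0 := mul_left_cancel₀ hu (by linear_combination -e01)
      refine ⟨?_, e00, h11⟩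
      rw [h11, e00] at hd
      exact mul_self_eq_one_iff.1 (by linear_combination hd)
    refine Set.ncard_congr (fun k _ ↦ (k.1 0 0, k.1 0 1)) ?_ ?_ ?_
    · intro k h
      simpa using (hk k h).1
    · intro a b ha hb h
      simp only [Prod.mk.injEq] at h
      obtain ⟨-, ha1, ha2⟩ := hk a ha
      obtain ⟨-, hb1, hb2⟩ := hk b hb
      exact eq_of_entries h.1 h.2 (ha1.trans hb1.symm) (by rw [ha2, hb2, h.1])
    · rintro ⟨e, b⟩ ⟨he, -⟩
      have he2 : e * e = 1 := by
        rcases he with rfl | rfl <;> ring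
      refine ⟨⟨!![e, b; 0, e], by rw [Matrix.det_fin_two_of]; linear_combination he2⟩,
        Subtype.ext ?_, by simp⟩
      change !![e, b; 0, e] * !![1, u; 0, 1] = !![1, u; 0, 1] * !![e, b; 0, e]
      ext i j
      fin_cases i <;> fin_cases j <;> simp [Matrix.mul_apply, Fin.sum_univ_two]
      ring
  rw [key, Set.ncard_prod, Set.ncard_pair hne, Set.ncard_univ]

lemma abs_ncard_conjugatesOf_upperUnipotent_sub_le (hq : Odd (Nat.card F)) {u : F} (hu : u ≠ 0) :
    |((conjugatesOf (upperUnipotent u)).ncard : ℝ) - 1 / 2 * (Nat.card F : ℝ) ^ 2| ≤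
      (Nat.card F : ℝ) := by
  have h1 := ncard_conjugatesOf_mul_ncard_commute (upperUnipotent u)
  rw [ncard_commute_upperUnipotent hq hu] at h1
  have h2 := abs_card_sub_le (F := F)
  rw [← h1] at h2
  have hq0 : (0 : ℝ) < Nat.card F := by exact_mod_cast Nat.card_pos
  push_cast at h2
  rw [abs_le] at h2 ⊢
  constructor
  · refine le_of_mul_le_mul_left ?_ hq0
    nlinarith
  · refine le_of_mul_le_mul_left ?_ hq0
    nlinarith

end Matrix.SpecialLinearGroup

/-! ### A quadratic character sum. -/

namespace FiniteField

/-- About three quarters of the elements `t` of a finite field of odd order are such that `2 - t` or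
`2 + t` is a square. -/
lemma abs_card_isSquare_or_sub_le {F : Type*} [Field F] [Finite F] (hq : Odd (Nat.card F))
    (R : Finset F) (hR : ∀ t, t ∈ R ↔ IsSquare (2 - t) ∨ IsSquare (2 + t)) :
    |(R.card : ℝ) - 3 / 4 * Nat.card F| ≤ 1 := by
  classical
  have h2 := two_ne_zero_of_odd_card hq
  have h4 := four_ne_zero_of_odd_card hq
  have := Fintype.ofFinite F
  have hchar : ringChar F ≠ 2 := by
    intro h
    apply h2
    have := ringChar.Nat.cast_ringChar (R := F)
    rw [h] at this
    exact_mod_cast this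
  set χ := quadraticChar F with hχ
  have hχ4 : χ 4 = 1 := by
    rw [show (4 : F) = 2 ^ 2 by norm_num]
    exact quadraticChar_sq_one' h2
  -- The product detects two nonsquares. If one argument is 0, the other is `4`, a nonzero square,
  -- so the product still vanishes.
  have hterm : ∀ t : F, (1 - χ (2 - t)) * (1 - χ (2 + t)) = if t ∈ R then 0 else 4 := by
    intro t
    by_cases h1 : 2 - t = 0
    · have ht : 2 + t = 4 := by linear_combination -h1
      have : t ∈ R := (hR t).2 (Or.inl (by rw [h1]; exact IsSquare.zero))
      rw [ht, hχ4, if_pos this]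
      ring
    by_cases h3 : 2 + t = 0
    · have ht : 2 - t = 4 := by linear_combination -h3
      have : t ∈ R := (hR t).2 (Or.inr (by rw [h3]; exact IsSquare.zero))
      rw [ht, hχ4, if_pos this]
      ring
    split_ifs with h
    · rcases (hR t).1 h with h | h
      · rw [(quadraticChar_one_iff_isSquare h1).2 h]; ring
      · rw [(quadraticChar_one_iff_isSquare h3).2 h]; ring
    · rw [hR, not_or] at h
      rw [quadraticChar_neg_one_iff_not_isSquare.2 h.1,
        quadraticChar_neg_one_iff_not_isSquare.2 h.2]
      norm_num
  have hsum : ∑ t : F, (1 - χ (2 - t)) * (1 - χ (2 + t)) = 4 * ((Fintype.card F : ℤ) - R.card) := by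
    simp_rw [hterm]
    rw [Finset.sum_ite, Finset.sum_const_zero, zero_add, Finset.sum_const]
    have h5 : (Finset.univ.filter fun t ↦ ¬ t ∈ R) = Rᶜ := by
      ext t
      simp
    rw [h5, Finset.card_compl, nsmul_eq_mul, Nat.cast_sub (Finset.card_le_univ R)]
    ring
  have hs1 : ∑ t : F, χ (2 - t) = 0 := by
    rw [← quadraticChar_sum_zero hchar]
    exact (Equiv.subLeft (2 : F)).sum_comp (fun t ↦ χ t)
  have hs2 : ∑ t : F, χ (2 + t) = 0 := by
    rw [← quadraticChar_sum_zero hchar]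
    exact Equiv.sum_comp (Equiv.addLeft (2 : F)) (fun t ↦ χ t)
  -- The substitution `t = 2 - 4x` turns the sum into the Jacobi sum of `χ` with itself, and `χ =
  -- χ⁻¹`.
  have hs3 : ∑ t : F, χ (2 - t) * χ (2 + t) = -χ (-1) := by
    have hinv : χ⁻¹ = χ := (quadraticChar_isQuadratic F).inv
    have hj := jacobiSum_nontrivial_inv (quadraticChar_ne_one hchar)
    rw [← hχ, hinv, jacobiSum] at hj
    rw [← hj, ← ((Equiv.mulLeft₀ (4 : F) h4).trans (Equiv.subLeft (2 : F))).sum_comp]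
    refine Finset.sum_congr rfl fun x _ ↦ ?_
    simp only [Equiv.trans_apply, Equiv.subLeft_apply, Equiv.mulLeft₀_apply]
    rw [show 2 - (2 - 4 * x) = 4 * x by ring, show 2 + (2 - 4 * x) = 4 * (1 - x) by ring,
      map_mul, map_mul, hχ4, one_mul, one_mul]
  have hexp : ∑ t : F, (1 - χ (2 - t)) * (1 - χ (2 + t)) = (Fintype.card F : ℤ) - χ (-1) := by
    have : ∀ t : F, (1 - χ (2 - t)) * (1 - χ (2 + t)) =
        1 - χ (2 - t) - χ (2 + t) + χ (2 - t) * χ (2 + t) := fun t ↦ by ring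
    simp_rw [this]
    rw [Finset.sum_add_distrib, Finset.sum_sub_distrib, Finset.sum_sub_distrib, hs1, hs2, hs3]
    simp
    ring
  rw [hexp] at hsum
  have hd := quadraticChar_dichotomy (F := F) (a := -1) (by simp)
  rw [Nat.card_eq_fintype_card]
  have hsum' : (Fintype.card F : ℝ) - (χ (-1) : ℤ) = 4 * ((Fintype.card F : ℝ) - R.card) := by
    exact_mod_cast hsum
  rw [abs_le]
  rcases hd with h | h <;> rw [← hχ] at h <;> rw [h] at hsum' <;> push_cast at hsum' <;>
    constructor <;> linarith

end FiniteField

/-! ### Unipotent matrices and traces of their products. -/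

namespace Matrix.SpecialLinearGroup

variable {F : Type*} [Field F]

/-- The parameter `u` is kept because conjugation in `SL(2, F)` rescales it only by squares. -/
lemma exists_isConj_upperUnipotent (A : SL(2, F)) (hA : A.1.trace = 2) (h1 : A ≠ 1) :
    ∃ u : F, u ≠ 0 ∧ IsConj A (upperUnipotent u) := by
  have hd := det_fin_two_eq_one A
  rw [Matrix.trace_fin_two] at hA
  have h11 : A.1 1 1 = 2 - A.1 0 0 := by linear_combination hA
  rw [h11] at hd
  by_cases hz : A.1 1 0 = 0
  · rw [hz] at hd
    have h00 : A.1 0 0 = 1 := by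
      have : (A.1 0 0 - 1) ^ 2 = 0 := by linear_combination -hd
      exact sub_eq_zero.1 ((pow_eq_zero_iff two_ne_zero).1 this)
    have h11' : A.1 1 1 = 1 := by linear_combination h11 - h00
    have hu : A = upperUnipotent (A.1 0 1) := by
      apply eq_of_entries <;> simp [upperUnipotent, h00, hz, h11']
    refine ⟨A.1 0 1, ?_, ?_⟩
    · intro h
      apply h1
      apply eq_of_entries <;> simp [h00, hz, h11', h]
    · rw [← hu]
  · refine ⟨-(A.1 1 0)⁻¹, by simpa using hz, IsConj.symm ?_⟩
    -- The columns are `(A - 1)e₁`, which `A` fixes because `(A - 1)² = 0`, and the multiple of `e₁`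
    -- that makes the determinant 1.
    let P : SL(2, F) := ⟨!![A.1 0 0 - 1, -(A.1 1 0)⁻¹; A.1 1 0, 0], by
      rw [Matrix.det_fin_two_of]; field_simp; ring⟩
    refine isConj_of_mul_eq_mul (c := P) (Subtype.ext ?_)
    change !![A.1 0 0 - 1, -(A.1 1 0)⁻¹; A.1 1 0, 0] * !![1, -(A.1 1 0)⁻¹; 0, 1] =
      A.1 * !![A.1 0 0 - 1, -(A.1 1 0)⁻¹; A.1 1 0, 0]
    ext i j
    fin_cases i <;> fin_cases j <;> simp [Matrix.mul_apply, Fin.sum_univ_two, h11, hz]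
    · linear_combination hd
    · ring
    · ring

/-- After a common conjugation one factor is `upperUnipotent u` itself, and only the lower left
entry of the relative conjugator `k` enters the trace. It enters squared, which is the obstruction
behind the limit `3/4`. -/
lemma trace_mul_of_isConj_upperUnipotent {u : F} {A B : SL(2, F)}
    (hA : IsConj (upperUnipotent u) A) (hB : IsConj (upperUnipotent u) B) :
    ∃ s : F, (A * B).1.trace = 2 - s ^ 2 := by
  obtain ⟨g, rfl⟩ := isConj_iff.1 hA
  obtain ⟨h, rfl⟩ := isConj_iff.1 hB
  let k := g⁻¹ * h
  have hconj : IsConj (g * upperUnipotent u * g⁻¹ * (h * upperUnipotent u * h⁻¹))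
      (upperUnipotent u * (k * upperUnipotent u * k⁻¹)) :=
    isConj_iff.2 ⟨g⁻¹, by simp only [k]; group⟩
  refine ⟨u * k.1 1 0, ?_⟩
  rw [trace_eq_of_isConj hconj]
  have hd := det_fin_two_eq_one k
  change (!![1, u; 0, 1] * (k.1 * !![1, u; 0, 1] * k.1.adjugate)).trace = _
  rw [Matrix.adjugate_fin_two, Matrix.trace_fin_two]
  simp [Matrix.mul_apply, Fin.sum_univ_two]
  linear_combination 2 * hd

/-- The lower unipotent matrix with entry `-s²/u` is conjugate to `upperUnipotent u`, and the
product of the two has trace `2 - s²`; away from `±2` the trace fixes the class. -/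
lemma exists_isConj_upperUnipotent_mul_eq [Finite F] {u : F} (hu : u ≠ 0) (M : SL(2, F)) (s : F)
    (hs : M.1.trace = 2 - s ^ 2) (hM : M.1.trace ^ 2 ≠ 4) :
    ∃ E H : SL(2, F), IsConj (upperUnipotent u) E ∧ IsConj (upperUnipotent u) H ∧ E * H = M := by
  have hs0 : s ≠ 0 := by
    rintro rfl
    apply hM
    rw [hs]
    ring
  let B : SL(2, F) := ⟨!![1, 0; -(s ^ 2 / u), 1], by simp⟩
  have hB : IsConj (upperUnipotent u) B := by
    let P : SL(2, F) := ⟨!![0, -(u / s); s / u, 0], by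
      rw [Matrix.det_fin_two_of]; field_simp; ring⟩
    refine isConj_of_mul_eq_mul (c := P) (Subtype.ext ?_)
    change !![0, -(u / s); s / u, 0] * !![1, u; 0, 1] =
      !![1, 0; -(s ^ 2 / u), 1] * !![0, -(u / s); s / u, 0]
    ext i j
    fin_cases i <;> fin_cases j <;> simp [Matrix.mul_apply, Fin.sum_univ_two]
    field_simp
  have ht : (upperUnipotent u * B).1.trace = M.1.trace := by
    rw [hs]
    change (!![1, u; 0, 1] * !![1, 0; -(s ^ 2 / u), 1]).trace = _
    rw [Matrix.trace_fin_two]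
    simp [Matrix.mul_apply, Fin.sum_univ_two]
    field_simp
    ring
  obtain ⟨E, H, h1, h2, h3⟩ := exists_isConj_mul (isConj_of_trace_eq ht (by rwa [ht]))
  exact ⟨E, H, h1, hB.trans h2, h3⟩

end Matrix.SpecialLinearGroup

/-! ### The centre, and classes and their squares in `PSL2 F`. -/

namespace Matrix.SpecialLinearGroup

variable {F : Type*} [Field F]

lemma mem_center_fin_two_iff {A : SL(2, F)} :
    A ∈ Subgroup.center SL(2, F) ↔ A = 1 ∨ A = -1 := by
  rw [mem_center_iff]
  constructor
  · rintro ⟨r, hr, h⟩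
    rw [Fintype.card_fin] at hr
    rcases mul_self_eq_one_iff.1 (by rw [← hr]; ring : r * r = 1) with rfl | rfl
    · left; apply Subtype.ext; rw [← h]; simp
    · right; apply Subtype.ext; rw [← h]; ext i j; fin_cases i <;> fin_cases j <;> simp
  · rintro (rfl | rfl)
    · exact ⟨1, by simp, by simp⟩
    · exact ⟨-1, by simp, by rw [coe_neg]; ext i j; fin_cases i <;> fin_cases j <;> simp⟩

lemma card_center_of_odd [Finite F] (hq : Odd (Nat.card F)) :
    Nat.card (Subgroup.center SL(2, F)) = 2 := by
  have h : ((Subgroup.center SL(2, F) : Subgroup SL(2, F)) : Set SL(2, F)) = {1, -1} := by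
    ext A
    simp [mem_center_fin_two_iff]
  have hne : (1 : SL(2, F)) ≠ -1 := by
    intro h
    have h00 : (1 : F) = -1 := by simpa using congrArg (fun M : SL(2, F) ↦ M.1 0 0) h
    apply FiniteField.two_ne_zero_of_odd_card hq
    linear_combination h00
  rw [← SetLike.coe_sort_coe, h, Nat.card_coe_set_eq, Set.ncard_pair hne]

lemma neg_eq_self_of_two_eq_zero (h2 : (2 : F) = 0) (A : SL(2, F)) : -A = A := by
  apply Subtype.ext
  rw [coe_neg]
  ext i j
  rw [Matrix.neg_apply]
  linear_combination -A.1 i j * h2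

lemma card_center_of_even [Finite F] (hq : Even (Nat.card F)) :
    Nat.card (Subgroup.center SL(2, F)) = 1 := by
  have h : ((Subgroup.center SL(2, F) : Subgroup SL(2, F)) : Set SL(2, F)) = {1} := by
    ext A
    simp [mem_center_fin_two_iff,
      neg_eq_self_of_two_eq_zero (FiniteField.two_eq_zero_of_even_card hq)]
  rw [← SetLike.coe_sort_coe, h, Nat.card_coe_set_eq, Set.ncard_singleton]

lemma trace_neg (A : SL(2, F)) : (-A).1.trace = -A.1.trace := by
  rw [coe_neg, Matrix.trace_neg]

end Matrix.SpecialLinearGroup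

namespace PSL2

open Matrix.SpecialLinearGroup

variable {F : Type*} [Field F]

lemma mk_eq_mk_iff {A B : SL(2, F)} :
    (QuotientGroup.mk A : PSL2 F) = QuotientGroup.mk B ↔ B = A ∨ B = -A := by
  rw [QuotientGroup.eq, mem_center_fin_two_iff, inv_mul_eq_iff_eq_mul, inv_mul_eq_iff_eq_mul,
    mul_one, mul_neg_one]

lemma mk_neg (A : SL(2, F)) : (QuotientGroup.mk (-A) : PSL2 F) = QuotientGroup.mk A :=
  mk_eq_mk_iff.2 (Or.inr (neg_neg A).symm)

lemma mk_mem_conjugatesOf_iff {A B : SL(2, F)} :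
    (QuotientGroup.mk B : PSL2 F) ∈ conjugatesOf (QuotientGroup.mk A : PSL2 F) ↔
      IsConj A B ∨ IsConj A (-B) := by
  rw [conjugatesOf, Set.mem_ofPred_eq, isConj_iff]
  constructor
  · rintro ⟨c, hc⟩
    obtain ⟨c, rfl⟩ := QuotientGroup.mk_surjective c
    have hc' : (QuotientGroup.mk (c * A * c⁻¹) : PSL2 F) = QuotientGroup.mk B := hc
    rcases mk_eq_mk_iff.1 hc' with h | h
    · exact Or.inl (isConj_iff.2 ⟨c, h.symm⟩)
    · exact Or.inr (isConj_iff.2 ⟨c, by rw [h, neg_neg]⟩)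
  · rintro (h | h)
    · obtain ⟨c, rfl⟩ := isConj_iff.1 h
      exact ⟨QuotientGroup.mk c, rfl⟩
    · obtain ⟨c, hc⟩ := isConj_iff.1 h
      refine ⟨QuotientGroup.mk c, ?_⟩
      rw [← mk_neg B, ← hc]
      rfl

/-- Each factor has a lift conjugate to `A` itself, so the sign ambiguity is left only in the
product. -/
lemma mk_mem_conjugatesOf_mul_iff {A M : SL(2, F)} :
    (QuotientGroup.mk M : PSL2 F) ∈
        (conjugatesOf (QuotientGroup.mk A : PSL2 F) * conjugatesOf (QuotientGroup.mk A : PSL2 F) :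
          Set (PSL2 F)) ↔
      ∃ E H : SL(2, F), IsConj A E ∧ IsConj A H ∧ (E * H = M ∨ E * H = -M) := by
  have key : ∀ y ∈ conjugatesOf (QuotientGroup.mk A : PSL2 F),
      ∃ E : SL(2, F), IsConj A E ∧ QuotientGroup.mk E = y := by
    intro y hy
    obtain ⟨E, rfl⟩ := QuotientGroup.mk_surjective y
    rcases mk_mem_conjugatesOf_iff.1 hy with h | h
    · exact ⟨E, h, rfl⟩
    · exact ⟨-E, h, mk_neg E⟩
  rw [Set.mem_mul]
  constructor
  · rintro ⟨y, hy, z, hz, h⟩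
    obtain ⟨E, hE, rfl⟩ := key y hy
    obtain ⟨H, hH, rfl⟩ := key z hz
    refine ⟨E, H, hE, hH, ?_⟩
    have h' : (QuotientGroup.mk (E * H) : PSL2 F) = QuotientGroup.mk M := h
    rcases mk_eq_mk_iff.1 h' with h | h
    · exact Or.inl h.symm
    · exact Or.inr (by rw [h, neg_neg])
  · rintro ⟨E, H, hE, hH, h⟩
    refine ⟨QuotientGroup.mk E, mk_mem_conjugatesOf_iff.2 (Or.inl hE), QuotientGroup.mk H,
      mk_mem_conjugatesOf_iff.2 (Or.inl hH), ?_⟩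
    rcases h with h | h
    · rw [← h]; rfl
    · rw [← mk_neg M, ← h]; rfl

lemma ncard_preimage_mk (S : Set (PSL2 F)) :
    ((QuotientGroup.mk : SL(2, F) → PSL2 F) ⁻¹' S).ncard =
      Nat.card (Subgroup.center SL(2, F)) * S.ncard := by
  rw [← Nat.card_coe_set_eq, ← Nat.card_coe_set_eq,
    Nat.card_congr (QuotientGroup.preimageMkEquivSubgroupProdSet _ S), Nat.card_prod]

lemma card_center_mul_card :
    Nat.card (Subgroup.center SL(2, F)) * Nat.card (PSL2 F) = Nat.card SL(2, F) := by
  have h := ncard_preimage_mk (Set.univ : Set (PSL2 F))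
  rw [Set.preimage_univ, Set.ncard_univ, Set.ncard_univ] at h
  exact h.symm

variable [Finite F]

lemma abs_card_center_mul_card_sub_le :
    |(Nat.card (Subgroup.center SL(2, F)) : ℝ) * Nat.card (PSL2 F) - (Nat.card F : ℝ) ^ 3| ≤
      (Nat.card F : ℝ) ^ 2 := by
  rw [← Nat.cast_mul, card_center_mul_card]
  exact abs_card_sub_le

/-- If every matrix of trace different from `±2` is a product of two conjugates of `A`, then the
square of the class of `A` in `PSL₂(F)` is almost everything. -/
lemma abs_ncard_sq_sub_le_of_forall_exists_mul (A : SL(2, F))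
    (hA : ∀ M : SL(2, F), M.1.trace ^ 2 ≠ 4 → ∃ E H, IsConj A E ∧ IsConj A H ∧ E * H = M) :
    |(Nat.card (Subgroup.center SL(2, F)) : ℝ) *
        (conjugatesOf (QuotientGroup.mk A : PSL2 F) *
          conjugatesOf (QuotientGroup.mk A : PSL2 F) : Set (PSL2 F)).ncard -
      (Nat.card F : ℝ) ^ 3| ≤ 4 * (Nat.card F : ℝ) ^ 2 := by
  classical
  have := Fintype.ofFinite F
  rw [← Nat.cast_mul, ← ncard_preimage_mk]
  set P := (QuotientGroup.mk : SL(2, F) → PSL2 F) ⁻¹' (conjugatesOf (QuotientGroup.mk A : PSL2 F) *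
    conjugatesOf (QuotientGroup.mk A : PSL2 F) : Set (PSL2 F)) with hP
  let S : Finset F := Finset.univ.filter fun t ↦ t ^ 2 ≠ 4
  have hS : Nat.card F ≤ S.card + 2 := by
    have h1 : (Finset.univ : Finset F) ⊆ S ∪ {2, -2} := by
      intro t _
      by_cases ht : t ^ 2 = 4
      · have : (t - 2) * (t + 2) = 0 := by linear_combination ht
        rcases mul_eq_zero.1 this with h | h
        · simp [sub_eq_zero.1 h]
        · simp [eq_neg_of_add_eq_zero_left h]
      · simp [S, ht]
    have h2 := (Finset.card_le_card h1).trans (Finset.card_union_le _ _)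
    rw [Finset.card_univ, ← Nat.card_eq_fintype_card] at h2
    exact h2.trans (Nat.add_le_add_left Finset.card_le_two _)
  have hsub : {M : SL(2, F) | M.1.trace ∈ S} ⊆ P := by
    intro M hM
    have hM' : M.1.trace ^ 2 ≠ 4 := by simpa [S] using hM
    obtain ⟨E, H, h1, h2, h3⟩ := hA M hM'
    exact mk_mem_conjugatesOf_mul_iff.2 ⟨E, H, h1, h2, Or.inl h3⟩
  have hlow : ({M : SL(2, F) | M.1.trace ∈ S}.ncard : ℝ) ≤ P.ncard := by
    exact_mod_cast Set.ncard_le_ncard hsub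
  have hup : (P.ncard : ℝ) ≤ Nat.card SL(2, F) := by
    rw [← Set.ncard_univ]
    exact_mod_cast Set.ncard_le_ncard (Set.subset_univ P)
  have h1 := abs_le.1 (abs_card_sub_le (F := F))
  have h2 := abs_le.1 (abs_ncard_trace_mem_sub_le S)
  have hS' : (Nat.card F : ℝ) ≤ S.card + 2 := by exact_mod_cast hS
  have hq : (1 : ℝ) ≤ Nat.card F := by exact_mod_cast Nat.card_pos (α := F)
  rw [abs_le]
  constructor
  · nlinarith [mul_nonneg (sub_nonneg.2 hS') (mul_nonneg (zero_le_one.trans hq) (sub_nonneg.2 hq))]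
  · nlinarith

/-- The preimage in `SL₂(F)` of a class whose trace is not `±2`. -/
lemma preimage_conjugatesOf_eq (A : SL(2, F)) (hA : A.1.trace ^ 2 ≠ 4) [DecidableEq F] :
    (QuotientGroup.mk : SL(2, F) → PSL2 F) ⁻¹' conjugatesOf (QuotientGroup.mk A : PSL2 F) =
      {M : SL(2, F) | M.1.trace ∈ ({A.1.trace, -A.1.trace} : Finset F)} := by
  ext B
  rw [Set.mem_preimage, mk_mem_conjugatesOf_iff, Set.mem_ofPred_eq, Finset.mem_insert,
    Finset.mem_singleton]
  refine or_congr ⟨fun h ↦ (trace_eq_of_isConj h).symm, fun h ↦ isConj_of_trace_eq h.symm hA⟩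
    ⟨fun h ↦ ?_, fun h ↦ isConj_of_trace_eq ?_ hA⟩
  · rw [trace_eq_of_isConj h, trace_neg, neg_neg]
  · rw [trace_neg, h, neg_neg]

lemma exists_isConj_mul_eq_of_sq_trace_ne (A : SL(2, F)) (hA : A.1.trace ^ 2 ≠ 4) (M : SL(2, F))
    (hM : M.1.trace ^ 2 ≠ 4) : ∃ E H, IsConj A E ∧ IsConj A H ∧ E * H = M := by
  obtain ⟨E, H, h1, h2, h3⟩ := exists_mul_eq_of_sq_trace_ne A.1.trace M hM
  exact ⟨E, H, isConj_of_trace_eq h1.symm hA, isConj_of_trace_eq h2.symm hA, h3⟩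

/-- Factors with the trace of `A` are conjugate to `A` unless they are 1. If one were 1, the common
trace would be `2 = 0`, and then so would the trace of the product, which is excluded. -/
lemma exists_isConj_mul_eq_of_even (hq : Even (Nat.card F)) (A : SL(2, F)) (hA : A ≠ 1)
    (M : SL(2, F)) (hM : M.1.trace ^ 2 ≠ 4) : ∃ E H, IsConj A E ∧ IsConj A H ∧ E * H = M := by
  have h2 := FiniteField.two_eq_zero_of_even_card hq
  obtain ⟨E, H, hE, hH, rfl⟩ := exists_mul_eq_of_sq_trace_ne A.1.trace M hM
  have htr : A.1.trace = 0 → (E * H).1.trace ≠ 0 := by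
    intro _ h
    apply hM
    rw [h]
    linear_combination (-2 : F) * h2
  have htr1 : (1 : SL(2, F)).1.trace = 0 := by
    change (1 : Matrix (Fin 2) (Fin 2) F).trace = 0
    rw [Matrix.trace_fin_two]
    simp
    linear_combination h2
  refine ⟨E, H, isConj_of_trace_eq_of_even hE.symm hA ?_ hq,
    isConj_of_trace_eq_of_even hH.symm hA ?_ hq, rfl⟩
  · rintro rfl
    rw [htr1] at hE
    rw [one_mul, hH] at htr
    exact htr hE.symm hE.symm
  · rintro rfl
    rw [htr1] at hH
    rw [mul_one, hE] at htr
    exact htr hH.symm hH.symm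

/-- The class is the trace fibre of `A`, with the identity removed if it lies there. -/
lemma abs_ncard_conjugatesOf_sub_le_of_even (hq : Even (Nat.card F)) (A : SL(2, F)) (hA : A ≠ 1) :
    |((conjugatesOf (QuotientGroup.mk A : PSL2 F)).ncard : ℝ) - (Nat.card F : ℝ) ^ 2| ≤
      4 * (Nat.card F : ℝ) := by
  have h2 := FiniteField.two_eq_zero_of_even_card hq
  have h := ncard_preimage_mk (conjugatesOf (QuotientGroup.mk A : PSL2 F))
  rw [card_center_of_even hq, one_mul] at h
  rw [← h]
  set P := (QuotientGroup.mk : SL(2, F) → PSL2 F) ⁻¹' conjugatesOf (QuotientGroup.mk A : PSL2 F)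
  have hup : P ⊆ {M : SL(2, F) | M.1.trace = A.1.trace} := by
    intro B hB
    rcases mk_mem_conjugatesOf_iff.1 hB with h | h
    · exact (trace_eq_of_isConj h).symm
    · rw [neg_eq_self_of_two_eq_zero h2] at h
      exact (trace_eq_of_isConj h).symm
  have hlow : {M : SL(2, F) | M.1.trace = A.1.trace} ⊆ insert 1 P := by
    intro B hB
    by_cases h1 : B = 1
    · exact Or.inl h1
    · exact Or.inr (mk_mem_conjugatesOf_iff.2
        (Or.inl (isConj_of_trace_eq_of_even (Eq.symm hB) hA h1 hq)))
  have hup' : (P.ncard : ℝ) ≤ {M : SL(2, F) | M.1.trace = A.1.trace}.ncard := by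
    exact_mod_cast Set.ncard_le_ncard hup
  have hlow' : ({M : SL(2, F) | M.1.trace = A.1.trace}.ncard : ℝ) ≤ P.ncard + 1 := by
    exact_mod_cast (Set.ncard_le_ncard hlow).trans (Set.ncard_insert_le _ _)
  have hb := abs_le.1 (abs_ncard_trace_eq_sub_le A.1.trace)
  have hq : (1 : ℝ) ≤ Nat.card F := by exact_mod_cast Nat.card_pos (α := F)
  rw [abs_le]
  constructor <;> linarith

/-- The preimage is two distinct fibres, over `±tr A`, and the projection is two to one. -/
lemma abs_ncard_conjugatesOf_sub_le_of_odd (hq : Odd (Nat.card F)) (A : SL(2, F))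
    (hA : A.1.trace ^ 2 ≠ 4) (h0 : A.1.trace ≠ 0) :
    |((conjugatesOf (QuotientGroup.mk A : PSL2 F)).ncard : ℝ) - (Nat.card F : ℝ) ^ 2| ≤
      4 * (Nat.card F : ℝ) := by
  classical
  have h := ncard_preimage_mk (conjugatesOf (QuotientGroup.mk A : PSL2 F))
  have hne : A.1.trace ≠ -A.1.trace := by
    intro h
    have : 2 * A.1.trace = 0 := by linear_combination h
    rcases mul_eq_zero.1 this with h | h
    · exact FiniteField.two_ne_zero_of_odd_card hq h
    · exact h0 h
  rw [card_center_of_odd hq, preimage_conjugatesOf_eq A hA] at h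
  have hb := abs_ncard_trace_mem_sub_le ({A.1.trace, -A.1.trace} : Finset F)
  rw [h, Finset.card_pair hne, abs_le] at hb
  push_cast at hb
  have hq : (1 : ℝ) ≤ Nat.card F := by exact_mod_cast Nat.card_pos (α := F)
  rw [abs_le]
  constructor <;> linarith

/-- The fibres over `±tr A` merge into one, so half a fibre survives in the quotient. -/
lemma abs_ncard_conjugatesOf_sub_le_of_trace_eq_zero (hq : Odd (Nat.card F)) (A : SL(2, F))
    (h0 : A.1.trace = 0) :
    |((conjugatesOf (QuotientGroup.mk A : PSL2 F)).ncard : ℝ) - 1 / 2 * (Nat.card F : ℝ) ^ 2| ≤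
      4 * (Nat.card F : ℝ) := by
  classical
  have h := ncard_preimage_mk (conjugatesOf (QuotientGroup.mk A : PSL2 F))
  rw [card_center_of_odd hq, preimage_conjugatesOf_eq A (by
    rw [h0]; simpa using (FiniteField.four_ne_zero_of_odd_card hq).symm), h0, neg_zero,
    Finset.pair_eq_singleton] at h
  have hb := abs_ncard_trace_mem_sub_le ({0} : Finset F)
  rw [h, Finset.card_singleton, abs_le] at hb
  push_cast at hb
  have hq : (1 : ℝ) ≤ Nat.card F := by exact_mod_cast Nat.card_pos (α := F)
  rw [abs_le]
  constructor <;> linarith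

/-- Traces `2` and `-2` separate the class in `SL(2, F)` from its negative, so it maps bijectively
onto its image. -/
lemma abs_ncard_conjugatesOf_upperUnipotent_sub_le (hq : Odd (Nat.card F)) {u : F} (hu : u ≠ 0) :
    |((conjugatesOf (QuotientGroup.mk (upperUnipotent u) : PSL2 F)).ncard : ℝ) -
      1 / 2 * (Nat.card F : ℝ) ^ 2| ≤ 4 * (Nat.card F : ℝ) := by
  have h2 := FiniteField.two_ne_zero_of_odd_card hq
  have h := ncard_preimage_mk (conjugatesOf (QuotientGroup.mk (upperUnipotent u) : PSL2 F))
  have htr : (upperUnipotent u).1.trace = 2 := by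
    simp [upperUnipotent, Matrix.trace_fin_two]
    norm_num
  have hP : (QuotientGroup.mk : SL(2, F) → PSL2 F) ⁻¹'
      conjugatesOf (QuotientGroup.mk (upperUnipotent u) : PSL2 F) =
        conjugatesOf (upperUnipotent u) ∪ Neg.neg '' conjugatesOf (upperUnipotent u) := by
    ext B
    rw [Set.mem_preimage, mk_mem_conjugatesOf_iff]
    refine or_congr Iff.rfl ⟨fun h ↦ ⟨-B, h, neg_neg B⟩, ?_⟩
    rintro ⟨C, hC, rfl⟩
    rwa [neg_neg]
  have hdisj : Disjoint (conjugatesOf (upperUnipotent u))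
      (Neg.neg '' conjugatesOf (upperUnipotent u)) := by
    rw [Set.disjoint_left]
    rintro _ hB ⟨C, hC, rfl⟩
    have h1 := trace_eq_of_isConj hB
    have h3 := trace_eq_of_isConj hC
    rw [trace_neg, ← h3, htr] at h1
    have : (2 : F) * 2 = 0 := by linear_combination h1
    exact mul_ne_zero h2 h2 this
  rw [card_center_of_odd hq, hP, Set.ncard_union_eq hdisj,
    Set.ncard_image_of_injective _ neg_injective] at h
  have hc : (conjugatesOf (QuotientGroup.mk (upperUnipotent u) : PSL2 F)).ncard =
    (conjugatesOf (upperUnipotent u)).ncard := by omega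
  rw [hc]
  have hb := abs_le.1
    (Matrix.SpecialLinearGroup.abs_ncard_conjugatesOf_upperUnipotent_sub_le hq hu)
  have hq : (1 : ℝ) ≤ Nat.card F := by exact_mod_cast Nat.card_pos (α := F)
  rw [abs_le]
  constructor <;> linarith

/-- The preimage lies between the fibres over `R'` and those over `R`, about `(3/4)q` fibres of `q²`
elements each; halving gives `3/8`. -/
lemma abs_ncard_sq_upperUnipotent_sub_le (hq : Odd (Nat.card F)) {u : F} (hu : u ≠ 0) :
    |((conjugatesOf (QuotientGroup.mk (upperUnipotent u) : PSL2 F) *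
        conjugatesOf (QuotientGroup.mk (upperUnipotent u) : PSL2 F) : Set (PSL2 F)).ncard : ℝ) -
      3 / 8 * (Nat.card F : ℝ) ^ 3| ≤ 4 * (Nat.card F : ℝ) ^ 2 := by
  classical
  have := Fintype.ofFinite F
  have h := ncard_preimage_mk (conjugatesOf (QuotientGroup.mk (upperUnipotent u) : PSL2 F) *
    conjugatesOf (QuotientGroup.mk (upperUnipotent u) : PSL2 F) : Set (PSL2 F))
  rw [card_center_of_odd hq] at h
  set C2 := (conjugatesOf (QuotientGroup.mk (upperUnipotent u) : PSL2 F) *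
    conjugatesOf (QuotientGroup.mk (upperUnipotent u) : PSL2 F) : Set (PSL2 F))
  let R : Finset F := Finset.univ.filter fun t ↦ IsSquare (2 - t) ∨ IsSquare (2 + t)
  have hR := FiniteField.abs_card_isSquare_or_sub_le hq R (by simp [R])
  let R' : Finset F := R \ {2, -2}
  have hRR' : R.card ≤ R'.card + 2 := by
    have := Finset.le_card_sdiff ({2, -2} : Finset F) R
    have := Finset.card_le_two (a := (2 : F)) (b := -2)
    simp only [R']
    omega
  have hup : QuotientGroup.mk ⁻¹' C2 ⊆ {M : SL(2, F) | M.1.trace ∈ R} := by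
    intro M hM
    obtain ⟨E, H, hE, hH, hEH⟩ := mk_mem_conjugatesOf_mul_iff.1 hM
    obtain ⟨s, hs⟩ := trace_mul_of_isConj_upperUnipotent hE hH
    simp only [Set.mem_ofPred_eq, R, Finset.mem_filter, Finset.mem_univ, true_and]
    rcases hEH with h | h
    · left
      rw [h] at hs
      exact ⟨s, by rw [hs]; ring⟩
    · right
      rw [h, trace_neg] at hs
      exact ⟨s, by linear_combination -hs⟩
  have hlow : {M : SL(2, F) | M.1.trace ∈ R'} ⊆ QuotientGroup.mk ⁻¹' C2 := by
    intro M hM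
    simp only [Set.mem_ofPred_eq, R', R, Finset.mem_sdiff, Finset.mem_filter, Finset.mem_univ,
      true_and, Finset.mem_insert, Finset.mem_singleton, not_or] at hM
    obtain ⟨hM1, hM2, hM3⟩ := hM
    have hM4 : M.1.trace ^ 2 ≠ 4 := by
      intro h
      have : (M.1.trace - 2) * (M.1.trace + 2) = 0 := by linear_combination h
      rcases mul_eq_zero.1 this with h | h
      · exact hM2 (sub_eq_zero.1 h)
      · exact hM3 (eq_neg_of_add_eq_zero_left h)
    rcases hM1 with ⟨s, hs⟩ | ⟨s, hs⟩
    · obtain ⟨E, H, hE, hH, hEH⟩ :=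
        exists_isConj_upperUnipotent_mul_eq hu M s (by linear_combination -hs) hM4
      exact mk_mem_conjugatesOf_mul_iff.2 ⟨E, H, hE, hH, Or.inl hEH⟩
    · obtain ⟨E, H, hE, hH, hEH⟩ :=
        exists_isConj_upperUnipotent_mul_eq hu (-M) s
          (by rw [trace_neg]; linear_combination -hs) (by rwa [trace_neg, neg_sq])
      exact mk_mem_conjugatesOf_mul_iff.2 ⟨E, H, hE, hH, Or.inr hEH⟩
  have hup' : (2 * C2.ncard : ℝ) ≤ {M : SL(2, F) | M.1.trace ∈ R}.ncard := by
    have := Set.ncard_le_ncard hup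
    rw [h] at this
    exact_mod_cast this
  have hlow' : ({M : SL(2, F) | M.1.trace ∈ R'}.ncard : ℝ) ≤ 2 * C2.ncard := by
    have := Set.ncard_le_ncard hlow
    rw [h] at this
    exact_mod_cast this
  have h1 := abs_le.1 (abs_ncard_trace_mem_sub_le R)
  have h2 := abs_le.1 (abs_ncard_trace_mem_sub_le R')
  have hR' := abs_le.1 hR
  have hRR'' : (R.card : ℝ) ≤ R'.card + 2 := by exact_mod_cast hRR'
  have hq : (1 : ℝ) ≤ Nat.card F := by exact_mod_cast Nat.card_pos (α := F)
  set q : ℝ := (Nat.card F : ℝ)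
  have hr : (R'.card : ℝ) ≤ q := by
    have : R'.card ≤ Nat.card F := by
      rw [Nat.card_eq_fintype_card]
      exact Finset.card_le_univ R'
    exact Nat.cast_le.2 this
  rw [abs_le]
  constructor
  · have e1 : 3 / 4 * q - 3 ≤ (R'.card : ℝ) := by linarith [hR'.1]
    have e2 := mul_le_mul_of_nonneg_right e1 (sq_nonneg q)
    have e3 := mul_le_mul_of_nonneg_right hr (zero_le_one.trans hq)
    nlinarith [h2.1]
  · have e1 : (R.card : ℝ) ≤ 3 / 4 * q + 1 := by linarith [hR'.2]
    have e2 := mul_le_mul_of_nonneg_right e1 (sq_nonneg q)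
    have e3 := mul_le_mul_of_nonneg_right e1 (zero_le_one.trans hq)
    nlinarith [h1.2]

end PSL2

/-! ### Reading lifts, traces and orders off the Jordan form. -/

namespace HasJordanForm

open Matrix.SpecialLinearGroup

variable {F : Type*} [Field F] {A : SL(2, F)} {J : Matrix (Fin 2) (Fin 2) (AlgebraicClosure F)}

lemma algebraMap_trace (h : HasJordanForm A J) :
    algebraMap F (AlgebraicClosure F) A.1.trace = J.trace := by
  obtain ⟨P, rfl⟩ := h
  rw [Matrix.trace_mul_comm, ← mul_assoc, ← Units.val_mul, inv_mul_cancel, Units.val_one, one_mul,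
    Matrix.trace_fin_two, Matrix.trace_fin_two]
  simp

lemma map_eq_scalar (c : F) (h : HasJordanForm A (algebraMap F (AlgebraicClosure F) c • 1)) :
    A.1 = c • 1 := by
  obtain ⟨P, h⟩ := h
  have h1 := congrArg (fun M ↦ (P⁻¹).1 * M * P.1) h
  simp only [mul_assoc] at h1
  rw [← Units.val_mul, inv_mul_cancel, Units.val_one, mul_one, ← mul_assoc, ← Units.val_mul,
    inv_mul_cancel, Units.val_one, one_mul, Matrix.smul_mul, Matrix.mul_smul, one_mul,
    ← Units.val_mul, inv_mul_cancel, Units.val_one] at h1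
  ext i j
  apply (algebraMap F (AlgebraicClosure F)).injective
  have h2 := congrFun (congrFun h1 i) j
  rw [Matrix.map_apply] at h2
  rw [h2]
  by_cases hij : i = j
  · subst hij; simp
  · simp [Matrix.one_apply_ne hij]

lemma eq_of_scalar (c : F) (hA : A.1 = c • 1) (h : HasJordanForm A J) :
    J = algebraMap F (AlgebraicClosure F) c • 1 := by
  obtain ⟨P, rfl⟩ := h
  have h1 : A.1.map (algebraMap F (AlgebraicClosure F)) =
      algebraMap F (AlgebraicClosure F) c • 1 := by
    rw [hA]
    ext i j
    by_cases hij : i = j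
    · subst hij; simp
    · simp [Matrix.one_apply_ne hij]
  change P.1 * A.1.map _ * (P⁻¹).1 = _
  rw [h1, Matrix.mul_smul, mul_one, Matrix.smul_mul, ← Units.val_mul, mul_inv_cancel,
    Units.val_one]

end HasJordanForm

namespace PSL2

open Matrix.SpecialLinearGroup

variable {F : Type*} [Field F]

/-- A unipotent element lifts to an upper unipotent matrix up to conjugation. -/
lemma IsUnipotent.exists_conj {x : PSL2 F} (hx : IsUnipotent x) :
    ∃ u : F, u ≠ 0 ∧ conjugatesOf x = conjugatesOf (QuotientGroup.mk (upperUnipotent u)) := by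
  suffices ∃ A : SL(2, F), (QuotientGroup.mk A : PSL2 F) = x ∧ A.1.trace = 2 ∧ A ≠ 1 by
    obtain ⟨A, rfl, htr, h1⟩ := this
    obtain ⟨u, hu, hconj⟩ := exists_isConj_upperUnipotent A htr h1
    refine ⟨u, hu, IsConj.conjugatesOf_eq ?_⟩
    obtain ⟨c, hc⟩ := isConj_iff.1 hconj
    exact isConj_iff.2 ⟨QuotientGroup.mk c, by rw [← hc]; rfl⟩
  obtain ⟨A, rfl, h | h⟩ := hx
  · refine ⟨A, rfl, ?_, ?_⟩
    · apply (algebraMap F (AlgebraicClosure F)).injective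
      rw [h.algebraMap_trace, Matrix.trace_fin_two]
      rw [map_ofNat]
      simp
      norm_num
    · rintro rfl
      have := h.eq_of_scalar 1 (by simp)
      simpa using congrFun (congrFun this 0) 1
  · refine ⟨-A, mk_neg A, ?_, ?_⟩
    · apply (algebraMap F (AlgebraicClosure F)).injective
      rw [trace_neg, map_neg, h.algebraMap_trace, Matrix.trace_fin_two]
      rw [map_ofNat]
      simp
      norm_num
    · intro hA
      rw [neg_eq_iff_eq_neg] at hA
      subst hA
      have := h.eq_of_scalar (-1) (by simp)
      simpa using congrFun (congrFun this 0) 1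

/-- If `a + a⁻¹ = ±2` then `a = ±1`, so the diagonalizable `A` is central. -/
lemma sq_trace_ne_four_of_hasJordanForm {A : SL(2, F)} (hA : (QuotientGroup.mk A : PSL2 F) ≠ 1)
    {a : AlgebraicClosure F} (ha : a ≠ 0) (h : HasJordanForm A !![a, 0; 0, a⁻¹]) :
    A.1.trace ^ 2 ≠ 4 := by
  intro htr
  have h1 := congrArg (algebraMap F (AlgebraicClosure F)) htr
  rw [map_pow, h.algebraMap_trace, Matrix.trace_fin_two] at h1
  simp only [Matrix.of_apply, Matrix.cons_val', Matrix.cons_val_zero, Matrix.cons_val_one,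
    Matrix.cons_val_fin_one, map_ofNat] at h1
  have h2 : (a * a - 1) ^ 2 = 0 := by
    field_simp at h1
    linear_combination h1
  have h3 : a * a = 1 := sub_eq_zero.1 ((pow_eq_zero_iff two_ne_zero).1 h2)
  apply hA
  rw [← QuotientGroup.mk_one, mk_eq_mk_iff]
  rcases mul_self_eq_one_iff.1 h3 with rfl | rfl
  · left
    apply Subtype.ext
    rw [HasJordanForm.map_eq_scalar (A := A) 1 (by
      convert h using 1
      ext i j
      fin_cases i <;> fin_cases j <;> simp)]
    simp
  · right
    apply Subtype.ext
    rw [coe_neg, HasJordanForm.map_eq_scalar (A := A) (-1) (by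
      convert h using 1
      ext i j
      fin_cases i <;> fin_cases j <;> simp [inv_neg])]
    simp

/-- Cayley–Hamilton in determinant 1; it ties involutions of `PSL2 F` to trace 0. -/
lemma mul_self_eq (A : SL(2, F)) : (A * A).1 = A.1.trace • A.1 - 1 := by
  have hd := det_fin_two_eq_one A
  change A.1 * A.1 = _
  ext i j
  fin_cases i <;> fin_cases j <;>
    simp [Matrix.mul_apply, Fin.sum_univ_two, Matrix.trace_fin_two]
  · linear_combination -hd
  · ring
  · ring
  · linear_combination -hd

lemma mk_sq_eq_one_of_trace_eq_zero {A : SL(2, F)} (hA : A.1.trace = 0) :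
    (QuotientGroup.mk A : PSL2 F) ^ 2 = 1 := by
  rw [sq, ← QuotientGroup.mk_mul, ← QuotientGroup.mk_one, mk_eq_mk_iff]
  right
  apply Subtype.ext
  rw [coe_neg, mul_self_eq, hA]
  simp

lemma trace_eq_zero_of_mk_sq_eq_one {A : SL(2, F)} (h1 : (QuotientGroup.mk A : PSL2 F) ≠ 1)
    (h : (QuotientGroup.mk A : PSL2 F) ^ 2 = 1) : A.1.trace = 0 := by
  have hd := det_fin_two_eq_one A
  by_contra h0
  rw [sq, ← QuotientGroup.mk_mul, ← QuotientGroup.mk_one, mk_eq_mk_iff] at h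
  rw [← QuotientGroup.mk_one, Ne, mk_eq_mk_iff] at h1
  have hm := mul_self_eq A
  -- If `A² = ±1`, Cayley–Hamilton makes `tr A • A` scalar; with nonzero trace `A` is then scalar of
  -- determinant 1, hence trivial in the quotient.
  have key : ∀ c : F, A.1.trace • A.1 = c • 1 → False := by
    intro c hc
    have h00 := congrFun (congrFun hc 0) 0
    have h01 := congrFun (congrFun hc 0) 1
    have h10 := congrFun (congrFun hc 1) 0
    have h11 := congrFun (congrFun hc 1) 1
    simp only [Matrix.smul_apply, smul_eq_mul, Matrix.one_apply_eq, ne_eq, Fin.isValue, zero_ne_one,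
      not_false_eq_true, Matrix.one_apply_ne, one_ne_zero, mul_zero, mul_eq_zero, h0,
      false_or] at h00 h01 h10 h11
    have h3 : A.1 1 1 = A.1 0 0 := mul_left_cancel₀ h0 (h11.trans h00.symm)
    rw [h01, h3] at hd
    apply h1
    rcases mul_self_eq_one_iff.1 (by linear_combination hd : A.1 0 0 * A.1 0 0 = 1) with h4 | h4
    · left
      apply eq_of_entries <;> simp [h01, h10, h3, h4]
    · right
      apply eq_of_entries <;> simp [h01, h10, h3, h4]
  rcases h with h | h
  · rw [← h, coe_one] at hm
    exact key 2 (by rw [eq_sub_iff_add_eq] at hm; rw [← hm, two_smul])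
  · have : A * A = -1 := by rw [h, neg_neg]
    rw [this, coe_neg, coe_one] at hm
    exact key 0 (by rw [zero_smul]; rw [← sub_add_cancel (A.1.trace • A.1) 1, ← hm, neg_add_cancel])

end PSL2

/-! ### Passage to the limit. -/

/-- Uniform convergence of `c / g ^ (2 / 3)` and `s / g` when `c`, `g`, `s` are asymptotic to
`κ q²`, `γ q³`, `σ q³`. -/
lemma exists_forall_abs_div_rpow_sub_lt (κ γ σ : ℝ) (hγ : 0 < γ) (ε : ℝ) (hε : 0 < ε) :
    ∃ N : ℕ, ∀ q : ℕ, N ≤ q → ∀ c g s : ℝ, |c - κ * (q : ℝ) ^ 2| ≤ 4 * q →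
      |g - γ * (q : ℝ) ^ 3| ≤ 4 * (q : ℝ) ^ 2 → |s - σ * (q : ℝ) ^ 3| ≤ 4 * (q : ℝ) ^ 2 →
      |c / g ^ (2 / 3 : ℝ) - κ / γ ^ (2 / 3 : ℝ)| < ε ∧ |s / g - σ / γ| < ε := by
  have h1 : ContinuousAt (fun p : ℝ × ℝ ↦ p.1 / p.2 ^ (2 / 3 : ℝ)) (κ, γ) := by
    refine ContinuousAt.div continuousAt_fst ?_ (Real.rpow_pos_of_pos hγ _).ne'
    exact continuousAt_snd.rpow_const (Or.inl hγ.ne')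
  have h2 : ContinuousAt (fun p : ℝ × ℝ ↦ p.1 / p.2) (σ, γ) :=
    continuousAt_fst.div continuousAt_snd hγ.ne'
  obtain ⟨δ₁, hδ₁, h1⟩ := Metric.continuousAt_iff.1 h1 ε hε
  obtain ⟨δ₂, hδ₂, h2⟩ := Metric.continuousAt_iff.1 h2 ε hε
  -- After division by `q²` or `q³` all errors are at most `4 / q`. Including `γ` in the minimum
  -- also forces `g > 0`.
  obtain ⟨N, hN⟩ := exists_nat_gt (4 / min δ₁ (min δ₂ γ))
  have hδ : 0 < min δ₁ (min δ₂ γ) := lt_min hδ₁ (lt_min hδ₂ hγ)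
  refine ⟨N, fun q hq c g s hc hg hs ↦ ?_⟩
  have hqN : (N : ℝ) ≤ q := by exact_mod_cast hq
  have hq0 : (0 : ℝ) < q := (div_pos four_pos hδ).trans (hN.trans_le hqN)
  have hsmall : 4 / (q : ℝ) < min δ₁ (min δ₂ γ) := by
    rw [div_lt_comm₀ hq0 hδ]
    exact hN.trans_le hqN
  have hb : ∀ (n : ℕ) (z ζ : ℝ), |z - ζ * (q : ℝ) ^ (n + 1)| ≤ 4 * (q : ℝ) ^ n →
      |z / (q : ℝ) ^ (n + 1) - ζ| ≤ 4 / q := by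
    intro n z ζ hz
    have hp : (0 : ℝ) < (q : ℝ) ^ (n + 1) := pow_pos hq0 _
    have : z / (q : ℝ) ^ (n + 1) - ζ = (z - ζ * (q : ℝ) ^ (n + 1)) / (q : ℝ) ^ (n + 1) := by
      field_simp
    rw [this, abs_div, abs_of_pos hp, div_le_div_iff₀ hp hq0]
    calc _ ≤ 4 * (q : ℝ) ^ n * q := by gcongr
      _ = _ := by ring
  have hc' := (hb 1 c κ (by simpa using hc)).trans_lt hsmall
  have hg' := (hb 2 g γ hg).trans_lt hsmall
  have hs' := (hb 2 s σ hs).trans_lt hsmall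
  norm_num only at hc' hg' hs'
  have hgpos : 0 < g / (q : ℝ) ^ 3 := by
    have := (abs_lt.1 (hg'.trans_le ((min_le_right _ _).trans (min_le_right _ _)))).1
    linarith
  have hg0 : 0 < g := by
    have := mul_pos hgpos (pow_pos hq0 3)
    rwa [div_mul_cancel₀ _ (pow_pos hq0 3).ne'] at this
  constructor
  · have h3 := @h1 (c / (q : ℝ) ^ 2, g / (q : ℝ) ^ 3) (by
      rw [Prod.dist_eq, Real.dist_eq, Real.dist_eq]
      exact max_lt (hc'.trans_le (min_le_left _ _)) (hg'.trans_le (min_le_left _ _)))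
    rw [Real.dist_eq] at h3
    convert h3 using 3
    rw [Real.div_rpow hg0.le (pow_pos hq0 3).le, ← Real.rpow_natCast (q : ℝ) 3,
      ← Real.rpow_mul hq0.le]
    norm_num
    have := (Real.rpow_pos_of_pos hg0 (2 / 3)).ne'
    field_simp
  · have h3 := @h2 (s / (q : ℝ) ^ 3, g / (q : ℝ) ^ 3) (by
      rw [Prod.dist_eq, Real.dist_eq, Real.dist_eq]
      exact max_lt (hs'.trans_le ((min_le_right _ _).trans (min_le_left _ _)))
        (hg'.trans_le ((min_le_right _ _).trans (min_le_left _ _))))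
    rw [Real.dist_eq] at h3
    convert h3 using 3
    field_simp

namespace PSL2

open Matrix.SpecialLinearGroup

variable {F : Type*} [Field F] [Finite F]

lemma abs_card_sub_le_of_even (hq : Even (Nat.card F)) :
    |(Nat.card (PSL2 F) : ℝ) - 1 * (Nat.card F : ℝ) ^ 3| ≤ 4 * (Nat.card F : ℝ) ^ 2 := by
  have h := abs_card_center_mul_card_sub_le (F := F)
  rw [card_center_of_even hq, Nat.cast_one, one_mul] at h
  rw [one_mul]
  exact h.trans (by nlinarith [sq_nonneg (Nat.card F : ℝ)])

lemma abs_card_sub_le_of_odd (hq : Odd (Nat.card F)) :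
    |(Nat.card (PSL2 F) : ℝ) - 1 / 2 * (Nat.card F : ℝ) ^ 3| ≤ 4 * (Nat.card F : ℝ) ^ 2 := by
  have h := abs_card_center_mul_card_sub_le (F := F)
  rw [card_center_of_odd hq, abs_le] at h
  push_cast at h
  rw [abs_le]
  constructor <;> nlinarith [sq_nonneg (Nat.card F : ℝ)]

lemma abs_ncard_sq_sub_le_of_odd (hq : Odd (Nat.card F)) (A : SL(2, F))
    (hA : A.1.trace ^ 2 ≠ 4) :
    |((conjugatesOf (QuotientGroup.mk A : PSL2 F) *
        conjugatesOf (QuotientGroup.mk A : PSL2 F) : Set (PSL2 F)).ncard : ℝ) -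
      1 / 2 * (Nat.card F : ℝ) ^ 3| ≤ 4 * (Nat.card F : ℝ) ^ 2 := by
  have h := abs_ncard_sq_sub_le_of_forall_exists_mul A (exists_isConj_mul_eq_of_sq_trace_ne A hA)
  rw [card_center_of_odd hq, abs_le] at h
  push_cast at h
  rw [abs_le]
  constructor <;> nlinarith [sq_nonneg (Nat.card F : ℝ)]

end PSL2

lemma one_div_half_rpow : (1 : ℝ) / (1 / 2) ^ (2 / 3 : ℝ) = 4 ^ (1 / 3 : ℝ) := by
  rw [Real.div_rpow zero_le_one two_pos.le, Real.one_rpow, one_div_one_div,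
    show (4 : ℝ) = 2 ^ (2 : ℝ) by norm_num, ← Real.rpow_mul two_pos.le]
  norm_num

lemma half_div_half_rpow : (1 / 2 : ℝ) / (1 / 2) ^ (2 / 3 : ℝ) = 1 / 2 ^ (1 / 3 : ℝ) := by
  have h : (1 / 2 : ℝ) / (1 / 2) ^ (2 / 3 : ℝ) = (1 / 2) ^ (1 / 3 : ℝ) := by
    nth_rewrite 1 [← Real.rpow_one (1 / 2 : ℝ)]
    rw [← Real.rpow_sub (by norm_num)]
    norm_num
  rw [h, Real.div_rpow zero_le_one two_pos.le, Real.one_rpow]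

theorem corollary4 :
    -- `q` even, `x` nontrivial
    (∀ ε : ℝ, 0 < ε → ∃ N : ℕ, ∀ (F : Type u) [Field F] [Finite F],
      N ≤ Nat.card F → Even (Nat.card F) → ∀ x : PSL2 F, x ≠ 1 →
        |PSL2.classRatio x - 1| < ε ∧ |PSL2.squareRatio x - 1| < ε) ∧
    -- `q` odd, `x` semisimple of order greater than `2`
    (∀ ε : ℝ, 0 < ε → ∃ N : ℕ, ∀ (F : Type u) [Field F] [Finite F],
      N ≤ Nat.card F → Odd (Nat.card F) → ∀ x : PSL2 F, PSL2.IsSemisimple x → 2 < orderOf x →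
        |PSL2.classRatio x - (4 : ℝ) ^ (1 / 3 : ℝ)| < ε ∧ |PSL2.squareRatio x - 1| < ε) ∧
    -- `q` odd, `x` of order `2`
    (∀ ε : ℝ, 0 < ε → ∃ N : ℕ, ∀ (F : Type u) [Field F] [Finite F],
      N ≤ Nat.card F → Odd (Nat.card F) → ∀ x : PSL2 F, orderOf x = 2 →
        |PSL2.classRatio x - 1 / (2 : ℝ) ^ (1 / 3 : ℝ)| < ε ∧ |PSL2.squareRatio x - 1| < ε) ∧
    -- `q` odd, `x` unipotent
    (∀ ε : ℝ, 0 < ε → ∃ N : ℕ, ∀ (F : Type u) [Field F] [Finite F],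
      N ≤ Nat.card F → Odd (Nat.card F) → ∀ x : PSL2 F, PSL2.IsUnipotent x →
        |PSL2.classRatio x - 1 / (2 : ℝ) ^ (1 / 3 : ℝ)| < ε ∧
          |PSL2.squareRatio x - 3 / 4| < ε) := by
  refine ⟨fun ε hε ↦ ?_, fun ε hε ↦ ?_, fun ε hε ↦ ?_, fun ε hε ↦ ?_⟩
  · obtain ⟨N, hN⟩ := exists_forall_abs_div_rpow_sub_lt 1 1 1 one_pos ε hε
    refine ⟨N, fun F _ _ hF hq x hx ↦ ?_⟩
    obtain ⟨A, rfl⟩ := QuotientGroup.mk_surjective x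
    have hA : A ≠ 1 := by
      rintro rfl
      exact hx rfl
    have hsq := PSL2.abs_ncard_sq_sub_le_of_forall_exists_mul A
      (PSL2.exists_isConj_mul_eq_of_even hq A hA)
    rw [Matrix.SpecialLinearGroup.card_center_of_even hq, Nat.cast_one, one_mul,
      ← one_mul ((Nat.card F : ℝ) ^ 3)] at hsq
    have hc := PSL2.abs_ncard_conjugatesOf_sub_le_of_even hq A hA
    rw [← one_mul ((Nat.card F : ℝ) ^ 2)] at hc
    have h := hN _ hF _ _ _ hc (PSL2.abs_card_sub_le_of_even hq) hsq
    rw [Real.one_rpow, div_one] at h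
    exact h
  · obtain ⟨N, hN⟩ := exists_forall_abs_div_rpow_sub_lt 1 (1 / 2) (1 / 2) one_half_pos ε hε
    refine ⟨N, fun F _ _ hF hq x hx ho ↦ ?_⟩
    obtain ⟨A, rfl, a, ha, hJ⟩ := hx
    have hA : A.1.trace ^ 2 ≠ 4 := by
      refine PSL2.sq_trace_ne_four_of_hasJordanForm (fun h ↦ ?_) ha hJ
      rw [h, orderOf_one] at ho
      omega
    -- Trace 0 would give order at most 2.
    have h0 : A.1.trace ≠ 0 := by
      intro h0
      have := orderOf_le_of_pow_eq_one two_pos (PSL2.mk_sq_eq_one_of_trace_eq_zero h0)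
      omega
    have hc := PSL2.abs_ncard_conjugatesOf_sub_le_of_odd hq A hA h0
    rw [← one_mul ((Nat.card F : ℝ) ^ 2)] at hc
    have h := hN _ hF _ _ _ hc (PSL2.abs_card_sub_le_of_odd hq)
      (PSL2.abs_ncard_sq_sub_le_of_odd hq A hA)
    rw [one_div_half_rpow, div_self (by norm_num)] at h
    exact h
  · obtain ⟨N, hN⟩ := exists_forall_abs_div_rpow_sub_lt (1 / 2) (1 / 2) (1 / 2) one_half_pos ε hε
    refine ⟨N, fun F _ _ hF hq x ho ↦ ?_⟩
    obtain ⟨A, rfl⟩ := QuotientGroup.mk_surjective x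
    have h0 : A.1.trace = 0 := by
      refine PSL2.trace_eq_zero_of_mk_sq_eq_one (fun h ↦ ?_) (orderOf_dvd_iff_pow_eq_one.1 ho.dvd)
      rw [h, orderOf_one] at ho
      omega
    have hA : A.1.trace ^ 2 ≠ 4 := by
      rw [h0]
      simpa using (FiniteField.four_ne_zero_of_odd_card hq).symm
    have h := hN _ hF _ _ _ (PSL2.abs_ncard_conjugatesOf_sub_le_of_trace_eq_zero hq A h0)
      (PSL2.abs_card_sub_le_of_odd hq) (PSL2.abs_ncard_sq_sub_le_of_odd hq A hA)
    rw [half_div_half_rpow, div_self (by norm_num)] at h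
    exact h
  · obtain ⟨N, hN⟩ := exists_forall_abs_div_rpow_sub_lt (1 / 2) (1 / 2) (3 / 8) one_half_pos ε hε
    refine ⟨N, fun F _ _ hF hq x hx ↦ ?_⟩
    obtain ⟨u, hu, hconj⟩ := hx.exists_conj
    have h := hN _ hF _ _ _ (PSL2.abs_ncard_conjugatesOf_upperUnipotent_sub_le hq hu)
      (PSL2.abs_card_sub_le_of_odd hq) (PSL2.abs_ncard_sq_upperUnipotent_sub_le hq hu)
    rw [half_div_half_rpow, show (3 / 8 : ℝ) / (1 / 2) = 3 / 4 by norm_num, ← hconj] at h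
    exact h
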